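/- Let $G$ be a (real, finite-dimensional) semisimple Lie group with Lie algebra $\mathfrak g$ and Killing form $B(X,Y)=\operatorname{tr}(\operatorname{ad}X\circ\operatorname{ad}Y)$. Fix a Cartan involution $\theta$ of $\mathfrak g$, i.e. an involutive automorphism such that $(X,Y)\mapsto -B(X,\theta Y)$ is positive definite, and let $\mathfrak g=\mathfrak k\oplus\mathfrak p$ be the corresponding Cartan decomposition into the $+1$ and $-1$ eigenspaces of $\theta$. Let $B'=cB$ be any positive multiple ($c>0$) of the Killing form (for instance, if $\mathfrak g\otimes\mathbb C$ has a maximal root, the multiple for which this root has length $\sqrt2$), and equip $\mathfrak g$ with the inner product $$\langle X,Y\rangle=-B'(X,\theta Y),$$ which equals $B'$ on $\mathfrak p$, equals $-B'$ on $\mathfrak k$, and makes $\mathfrak k$ and $\mathfrak p$ orthogonal. Equip $G$ with the left-invariant Riemannian metric that it induces. With $\|X\|=\langle X,X\rangle^{1/2}$ and $N(f)=\sup\{\|f(X)\| : X\in\mathfrak g,\ \|X\|=1\}$ for an endomorphism $f$ of $\mathfrak g$, put $$C_1=\sup\{N(\operatorname{ad}X) : X\in\mathfrak p,\ \|X\|=1\},\qquad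 C_2=\sup\{N(\operatorname{ad}X) : X\in\mathfrak k,\ \|X\|=1\},$$ and suppose that $C_1\neq 0$ and let $\alpha=C_2/C_1$. If $\alpha=1$, then all sectional curvatures of $G$ are at most $\frac{49}{52}\,C_1^2$. If $\alpha=\sqrt2$, then all sectional curvatures of $G$ are at most $1.17259\cdot C_1^2$. -/

import Mathlib

open Bundle
open scoped Manifold ContDiff

/-! ### The algebra: Cartan involutions, the canonical inner product, the two constants -/

section LieAlgebraPart

variable {L : Type*} [LieRing L] [LieAlgebra ℝ L]

/-- A Cartan involution of a real Lie algebra: an involutive automorphism `θ` such that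
`(X, Y) ↦ -B (X, θ Y)` is positive definite, where `B` is the Killing form. The Cartan decomposition
that it fixes is `𝔨 ⊕ 𝔭`, with `𝔨` and `𝔭` the `+1` and `-1` eigenspaces of `θ`. -/
structure IsCartanInvolution (θ : L →ₗ⁅ℝ⁆ L) : Prop where
  involutive : ∀ X, θ (θ X) = X
  pos : ∀ X, X ≠ 0 → 0 < -killingForm ℝ L X (θ X)

/-- The subspace `𝔨`, the `+1` eigenspace of `θ`. -/
def cartanK (θ : L →ₗ⁅ℝ⁆ L) : Set L := {X | θ X = X}

/-- The subspace `𝔭`, the `-1` eigenspace of `θ`. -/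
def cartanP (θ : L →ₗ⁅ℝ⁆ L) : Set L := {X | θ X = -X}

/-- The form `⟨X, Y⟩ = -c B (X, θ Y)`: it equals `c B` on `𝔭`, `-c B` on `𝔨`, and `𝔨` and `𝔭` are
orthogonal. The factor `c` rescales the Killing form. -/
noncomputable def canonicalForm (c : ℝ) (θ : L →ₗ⁅ℝ⁆ L) : LinearMap.BilinForm ℝ L :=
  -(c • (killingForm ℝ L).compl₂ (θ : L →ₗ[ℝ] L))

/-- The length of a vector with respect to a form. -/
noncomputable def formLength (Q : LinearMap.BilinForm ℝ L) (X : L) : ℝ := Real.sqrt (Q X X)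

/-- The norm `N f = sup {‖f X‖ : ‖X‖ = 1}` of an endomorphism. -/
noncomputable def formOpNorm (Q : LinearMap.BilinForm ℝ L) (f : Module.End ℝ L) : ℝ :=
  sSup {r | ∃ X, formLength Q X = 1 ∧ r = formLength Q (f X)}

/-- `C₁ = sup {N (ad X) : X ∈ 𝔭, ‖X‖ = 1}`. -/
noncomputable def constC1 (θ : L →ₗ⁅ℝ⁆ L) (Q : LinearMap.BilinForm ℝ L) : ℝ :=
  sSup {r | ∃ X ∈ cartanP θ, formLength Q X = 1 ∧ r = formOpNorm Q (LieAlgebra.ad ℝ L X)}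

/-- `C₂ = sup {N (ad X) : X ∈ 𝔨, ‖X‖ = 1}`. -/
noncomputable def constC2 (θ : L →ₗ⁅ℝ⁆ L) (Q : LinearMap.BilinForm ℝ L) : ℝ :=
  sSup {r | ∃ X ∈ cartanK θ, formLength Q X = 1 ∧ r = formOpNorm Q (LieAlgebra.ad ℝ L X)}

end LieAlgebraPart

/-! ### The geometry: Levi-Civita connection and sectional curvature -/

section RiemannianPart

variable {n : ℕ} {M : Type*} [TopologicalSpace M] [ChartedSpace (EuclideanSpace ℝ (Fin n)) M]

/-- A field of bilinear forms on the tangent spaces of `M`. -/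
abbrev MetricField (n : ℕ) (M : Type*) [TopologicalSpace M]
    [ChartedSpace (EuclideanSpace ℝ (Fin n)) M] : Type _ :=
  ∀ x : M, TangentSpace (𝓡 n) x →ₗ[ℝ] TangentSpace (𝓡 n) x →ₗ[ℝ] ℝ

/-- A connection on the tangent bundle. On paper, `cov Y x (X x)` is the value of `∇_X Y` at `x`. -/
abbrev TangentConnection (n : ℕ) (M : Type*) [TopologicalSpace M]
    [ChartedSpace (EuclideanSpace ℝ (Fin n)) M] [IsManifold (𝓡 n) ∞ M] : Type _ :=
  CovariantDerivative (𝓡 n) (EuclideanSpace ℝ (Fin n)) (TangentSpace (𝓡 n) : M → Type _)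

/-- The Levi-Civita property: the connection is torsion free, and it is compatible with the
metric, `v ⟨Y, Z⟩ = ⟨∇_v Y, Z⟩ + ⟨Y, ∇_v Z⟩`. -/
structure IsLeviCivita [IsManifold (𝓡 n) ∞ M] (g : MetricField n M)
    (cov : TangentConnection n M) : Prop where
  torsion_free : cov.torsion = 0
  metric : ∀ (x : M) (v : TangentSpace (𝓡 n) x) (Y Z : ∀ y : M, TangentSpace (𝓡 n) y),
    MDifferentiableAt (𝓡 n) (𝓡 n).tangent (fun y ↦ (⟨y, Y y⟩ : TangentBundle (𝓡 n) M)) x →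
    MDifferentiableAt (𝓡 n) (𝓡 n).tangent (fun y ↦ (⟨y, Z y⟩ : TangentBundle (𝓡 n) M)) x →
      mvfderiv (𝓡 n) (fun y ↦ g y (Y y) (Z y)) x v = g x (cov Y x v) (Z x) + g x (Y x) (cov Z x v)

/-- The curvature `R(X, Y) Z = ∇_X ∇_Y Z - ∇_Y ∇_X Z - ∇_[X, Y] Z`. -/
noncomputable def curvature [IsManifold (𝓡 n) ∞ M] (cov : TangentConnection n M)
    (X Y Z : ∀ y : M, TangentSpace (𝓡 n) y) (x : M) : TangentSpace (𝓡 n) x :=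
  cov (fun y ↦ cov Z y (Y y)) x (X x) - cov (fun y ↦ cov Z y (X y)) x (Y x)
    - cov Z x (VectorField.mlieBracket (𝓡 n) X Y x)

/-- The sectional curvature at `x` of the plane spanned by `X x` and `Y x`,
`⟨R(X, Y) Y, X⟩ / (‖X‖² ‖Y‖² - ⟨X, Y⟩²)`. -/
noncomputable def sectionalCurvature [IsManifold (𝓡 n) ∞ M] (g : MetricField n M)
    (cov : TangentConnection n M) (X Y : ∀ y : M, TangentSpace (𝓡 n) y) (x : M) : ℝ :=
  g x (curvature cov X Y Y x) (X x) /
    (g x (X x) (X x) * g x (Y x) (Y x) - g x (X x) (Y x) ^ 2)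

/-- All sectional curvatures of the Riemannian metric `g`, at all points and for all tangent
planes, are at most `k`. -/
def SectionalCurvatureLE [IsManifold (𝓡 n) ∞ M] (g : MetricField n M) (k : ℝ) : Prop :=
  ∀ cov : TangentConnection n M, IsLeviCivita g cov →
    ∀ X Y : ∀ y : M, TangentSpace (𝓡 n) y,
      ContMDiff (𝓡 n) (𝓡 n).tangent ∞ (fun y ↦ (⟨y, X y⟩ : TangentBundle (𝓡 n) M)) →
      ContMDiff (𝓡 n) (𝓡 n).tangent ∞ (fun y ↦ (⟨y, Y y⟩ : TangentBundle (𝓡 n) M)) →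
      ∀ x : M, LinearIndependent ℝ ![X x, Y x] → sectionalCurvature g cov X Y x ≤ k

end RiemannianPart

/-! ### Lie groups with left-invariant metrics -/

section LieGroupPart

variable {n : ℕ} {G : Type*} [TopologicalSpace G] [ChartedSpace (EuclideanSpace ℝ (Fin n)) G]
  [Group G]

/-- A smooth Lie group has the regularity under which Mathlib equips its tangent space at the
identity with the Lie bracket. -/
instance lieGroup_minSmoothness [LieGroup (𝓡 n) ∞ G] : LieGroup (𝓡 n) (minSmoothness ℝ 3) G :=
  LieGroup.of_le (n := ∞) (by
    rw [minSmoothness_of_isRCLikeNormedField]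
    exact ENat.LEInfty.out)

/-- The left-invariant extension of a form on the Lie algebra `T₁ G`: at `x` it is the pullback of
the form under the differential of left translation by `x⁻¹`. -/
noncomputable def leftInvariantMetric (Q : LinearMap.BilinForm ℝ (GroupLieAlgebra (𝓡 n) G)) :
    MetricField n G := fun x ↦
  let T : TangentSpace (𝓡 n) x →ₗ[ℝ] GroupLieAlgebra (𝓡 n) G :=
    (mfderiv (𝓡 n) (𝓡 n) (fun y : G ↦ x⁻¹ * y) x).toLinearMap
  Q.compl₁₂ T T

end LieGroupPart

/-! ### Boundedness of bilinear maps in finite dimension. -/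

section BilinearBounds

variable {V : Type*} [AddCommGroup V] [Module ℝ V]

/-! The transpose of `ad X` for the canonical form is `-ad (θ X)`, so Koszul's formula on
left-invariant fields reads `∇_X Y = ½([X,Y] + [θY,X] + [θX,Y])` (`eq_leviCivitaProduct`). Split `X
= a + u`, `Y = b + v` with `a, b ∈ 𝔨` and `u, v ∈ 𝔭`. Then `⟨R(X,Y)Y,X⟩` equals `¼|[a,v]+[u,b]|² +
¼|[a,b]|² + 5/2⟨[a,b],[u,v]⟩ - 7/4|[u,v]|²` (`canonicalForm_productCurvature`).

The suprema give `|[a,b]| ≤ αC₁|a||b|`, and `C₁` alone controls the other brackets. What is left is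
an inequality between four lengths (`curvature_bound_of_component_bounds`), which holds with
constant `k` once a binary quadratic form is nonnegative. In the discriminant condition the `k²`
terms cancel, so it is linear in `k`. Both constants satisfy it with room to spare: for `α = 1` the
condition is `k ≥ 7/10`.

On the geometric side the vector fields are arbitrary smooth ones. Their curvature is reduced to the
algebraic one by expanding in a left-invariant frame (`leftTriv_curvature`). The derivatives of the
coefficients cancel because the bracket of fields is the commutator of derivations
(`mvfderiv_mlieBracket`). -/

lemma exists_norm_bilinear_le (W : Type*) [NormedAddCommGroup W] [NormedSpace ℝ W]
    [FiniteDimensional ℝ W] (f : W →ₗ[ℝ] W →ₗ[ℝ] W) :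
    ∃ K, 0 ≤ K ∧ ∀ x y, ‖f x y‖ ≤ K * ‖x‖ * ‖y‖ := by
  let F : W →L[ℝ] W →L[ℝ] W :=
    LinearMap.toContinuousLinearMap
      ((LinearMap.toContinuousLinearMap (E := W) (F' := W) (𝕜 := ℝ)).toLinearMap ∘ₗ f)
  exact ⟨‖F‖, norm_nonneg F, fun x y ↦ F.le_opNorm₂ x y⟩

/-- The form `Q` is itself an inner product, so this is continuity of a bilinear map in finite
dimension. It makes the sets defining `C₁` and `C₂` bounded above; the real `sSup` of an unbounded
set would be the junk value 0. -/
lemma exists_bilinear_bound [FiniteDimensional ℝ V] (Q : LinearMap.BilinForm ℝ V)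
    (hs : ∀ x y, Q x y = Q y x) (hp : ∀ x, x ≠ 0 → 0 < Q x x) (f : V →ₗ[ℝ] V →ₗ[ℝ] V) :
    ∃ K, 0 ≤ K ∧ ∀ x y, √(Q (f x y) (f x y)) ≤ K * √(Q x x) * √(Q y y) := by
  let core : InnerProductSpace.Core ℝ V :=
    { inner := fun x y ↦ Q x y
      conj_inner_symm := fun x y ↦ by simpa using hs y x
      re_inner_nonneg := fun x ↦ by
        rcases eq_or_ne x 0 with rfl | hx
        · simp
        · simpa using (hp x hx).le
      add_left := fun x y z ↦ by simp
      smul_left := fun x y r ↦ by simp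
      definite := fun x hx ↦ by
        by_contra h
        exact (hp x h).ne' hx }
  let _ : NormedAddCommGroup V := core.toNormedAddCommGroup
  let _ : InnerProductSpace ℝ V := InnerProductSpace.ofCore core.toCore
  exact exists_norm_bilinear_le V f

end BilinearBounds

/-! ### The canonical form, the Levi-Civita product and its curvature. -/

section CartanAlgebra

variable {L : Type*} [LieRing L] [LieAlgebra ℝ L]

lemma canonicalForm_apply (c : ℝ) (θ : L →ₗ⁅ℝ⁆ L) (X Y : L) :
    canonicalForm c θ X Y = -(c * killingForm ℝ L X (θ Y)) := by
  simp [canonicalForm]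

namespace IsCartanInvolution

variable {θ : L →ₗ⁅ℝ⁆ L} (hθ : IsCartanInvolution θ)

include hθ

/-- Since `ad (θ X) = θ ∘ ad X ∘ θ` and `θ² = 1`, this is cyclicity of the trace. -/
lemma killingForm_map (X Y : L) : killingForm ℝ L (θ X) (θ Y) = killingForm ℝ L X Y := by
  have h : ∀ Z, LieAlgebra.ad ℝ L (θ Z) =
      (θ : L →ₗ[ℝ] L) * LieAlgebra.ad ℝ L Z * (θ : L →ₗ[ℝ] L) := by
    intro Z
    ext W
    simp [hθ.involutive]
  have h2 : (θ : L →ₗ[ℝ] L) * (θ : L →ₗ[ℝ] L) = 1 := by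
    ext W
    simp [hθ.involutive]
  simp only [LieModule.traceForm_apply_apply]
  change LinearMap.trace ℝ L (LieAlgebra.ad ℝ L (θ X) * LieAlgebra.ad ℝ L (θ Y)) =
    LinearMap.trace ℝ L (LieAlgebra.ad ℝ L X * LieAlgebra.ad ℝ L Y)
  rw [h, h]
  calc _ = LinearMap.trace ℝ L ((θ : L →ₗ[ℝ] L) * (LieAlgebra.ad ℝ L X *
        ((θ : L →ₗ[ℝ] L) * (θ : L →ₗ[ℝ] L)) * LieAlgebra.ad ℝ L Y * (θ : L →ₗ[ℝ] L))) := by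
        simp only [mul_assoc]
    _ = _ := by
        rw [h2, LinearMap.trace_mul_comm]
        simp only [mul_assoc, h2, mul_one]

lemma canonicalForm_symm (c : ℝ) (X Y : L) : canonicalForm c θ X Y = canonicalForm c θ Y X := by
  rw [canonicalForm_apply, canonicalForm_apply, LieModule.traceForm_comm,
    ← hθ.killingForm_map, hθ.involutive]

lemma canonicalForm_pos {c : ℝ} (hc : 0 < c) {X : L} (hX : X ≠ 0) :
    0 < canonicalForm c θ X X := by
  rw [canonicalForm_apply, ← mul_neg]
  exact mul_pos hc (hθ.pos X hX)

lemma canonicalForm_self_nonneg {c : ℝ} (hc : 0 < c) (X : L) : 0 ≤ canonicalForm c θ X X := by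
  rcases eq_or_ne X 0 with rfl | h
  · simp
  · exact (hθ.canonicalForm_pos hc h).le

/-- The transpose of `ad X` is `-ad (θ X)`. -/
lemma canonicalForm_lie_left (c : ℝ) (X Y Z : L) :
    canonicalForm c θ ⁅X, Y⁆ Z = -canonicalForm c θ Y ⁅θ X, Z⁆ := by
  rw [canonicalForm_apply, canonicalForm_apply, ← lie_skew, map_neg, LinearMap.neg_apply,
    LieModule.traceForm_apply_lie_apply, LieHom.map_lie, hθ.involutive]
  ring

lemma canonicalForm_orthogonal (c : ℝ) {X Y : L} (hX : X ∈ cartanK θ) (hY : Y ∈ cartanP θ) :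
    canonicalForm c θ X Y = 0 := by
  have h := hθ.killingForm_map X Y
  have hX' : θ X = X := hX
  have hY' : θ Y = -Y := hY
  rw [hX', hY', map_neg] at h
  rw [canonicalForm_apply, hY', map_neg]
  have : killingForm ℝ L X Y = 0 := by linarith
  simp [this]

omit hθ in
lemma formLength_smul (Q : LinearMap.BilinForm ℝ L) (r : ℝ) (X : L) :
    formLength Q (r • X) = |r| * formLength Q X := by
  simp only [formLength, map_smul, LinearMap.smul_apply, smul_eq_mul]
  rw [← mul_assoc, Real.sqrt_mul (mul_self_nonneg r), Real.sqrt_mul_self_eq_abs]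

lemma formLength_sq {c : ℝ} (hc : 0 < c) (X : L) :
    formLength (canonicalForm c θ) X ^ 2 = canonicalForm c θ X X :=
  Real.sq_sqrt (hθ.canonicalForm_self_nonneg hc X)

lemma formLength_pos {c : ℝ} (hc : 0 < c) {X : L} (hX : X ≠ 0) :
    0 < formLength (canonicalForm c θ) X :=
  Real.sqrt_pos.2 (hθ.canonicalForm_pos hc hX)

/-- Normalize `X` and `Y` to unit length and rescale. The set `S` stands for `𝔨` or `𝔭`, and only
its stability under scaling matters. -/
lemma formLength_lie_le_of_sSup [FiniteDimensional ℝ L] {c : ℝ} (hc : 0 < c) (S : Set L)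
    (hS : ∀ (r : ℝ), ∀ X ∈ S, r • X ∈ S) {X : L} (hX : X ∈ S) (Y : L) :
    formLength (canonicalForm c θ) ⁅X, Y⁆ ≤
      sSup {r | ∃ X ∈ S, formLength (canonicalForm c θ) X = 1 ∧
        r = formOpNorm (canonicalForm c θ) (LieAlgebra.ad ℝ L X)} *
      formLength (canonicalForm c θ) X * formLength (canonicalForm c θ) Y := by
  set Q := canonicalForm c θ with hQ
  obtain ⟨K, hK0, hK⟩ := exists_bilinear_bound Q (hθ.canonicalForm_symm c)
    (fun x hx ↦ hθ.canonicalForm_pos hc hx) (LieAlgebra.ad ℝ L : L →ₗ[ℝ] L →ₗ[ℝ] L)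
  have hK' : ∀ x y, formLength Q ⁅x, y⁆ ≤ K * formLength Q x * formLength Q y := hK
  have hunit : ∀ Z : L, Z ≠ 0 → formLength Q ((formLength Q Z)⁻¹ • Z) = 1 := by
    intro Z hZ
    have := hθ.formLength_pos hc hZ
    rw [formLength_smul, abs_of_pos (inv_pos.2 this), inv_mul_cancel₀ this.ne']
  rcases eq_or_ne X 0 with rfl | hX0
  · simp [formLength]
  rcases eq_or_ne Y 0 with rfl | hY0
  · simp [formLength]
  have hlX : 0 < formLength Q X := hθ.formLength_pos hc hX0
  have hlY : 0 < formLength Q Y := hθ.formLength_pos hc hY0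
  set X₁ := (formLength Q X)⁻¹ • X with hX₁
  set Y₁ := (formLength Q Y)⁻¹ • Y with hY₁
  have bdd : ∀ Z, formLength Q Z = 1 → ∀ r ∈ {r | ∃ W, formLength Q W = 1 ∧
      r = formLength Q (LieAlgebra.ad ℝ L Z W)}, r ≤ K := by
    rintro Z hZ r ⟨W, hW, rfl⟩
    simpa [hZ, hW] using hK' Z W
  have h1 : formLength Q ⁅X₁, Y₁⁆ ≤ formOpNorm Q (LieAlgebra.ad ℝ L X₁) :=
    le_csSup ⟨K, bdd X₁ (hunit X hX0)⟩ ⟨Y₁, hunit Y hY0, rfl⟩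
  have h2 : formOpNorm Q (LieAlgebra.ad ℝ L X₁) ≤
      sSup {r | ∃ X ∈ S, formLength Q X = 1 ∧ r = formOpNorm Q (LieAlgebra.ad ℝ L X)} := by
    refine le_csSup ⟨K, ?_⟩ ⟨X₁, hS _ X hX, hunit X hX0, rfl⟩
    rintro r ⟨Z, -, hZ, rfl⟩
    exact Real.sSup_le (bdd Z hZ) hK0
  have h3 : ⁅X, Y⁆ = (formLength Q X * formLength Q Y) • ⁅X₁, Y₁⁆ := by
    rw [hX₁, hY₁, smul_lie, lie_smul, smul_smul, smul_smul,
      mul_assoc, mul_assoc, mul_left_comm (formLength Q Y), mul_inv_cancel₀ hlY.ne', mul_one,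
      mul_inv_cancel₀ hlX.ne', one_smul]
  rw [h3, formLength_smul, abs_of_pos (mul_pos hlX hlY), mul_assoc (sSup _), mul_comm (sSup _)]
  exact mul_le_mul_of_nonneg_left (h1.trans h2) (mul_pos hlX hlY).le

lemma formLength_lie_le_constC1 [FiniteDimensional ℝ L] {c : ℝ} (hc : 0 < c) {X : L}
    (hX : X ∈ cartanP θ) (Y : L) :
    formLength (canonicalForm c θ) ⁅X, Y⁆ ≤ constC1 θ (canonicalForm c θ) *
      formLength (canonicalForm c θ) X * formLength (canonicalForm c θ) Y := by
  refine hθ.formLength_lie_le_of_sSup hc (cartanP θ) (fun r X hX ↦ ?_) hX Y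
  have h : θ X = -X := hX
  change θ (r • X) = -(r • X)
  rw [map_smul, h, smul_neg]

lemma formLength_lie_le_constC2 [FiniteDimensional ℝ L] {c : ℝ} (hc : 0 < c) {X : L}
    (hX : X ∈ cartanK θ) (Y : L) :
    formLength (canonicalForm c θ) ⁅X, Y⁆ ≤ constC2 θ (canonicalForm c θ) *
      formLength (canonicalForm c θ) X * formLength (canonicalForm c θ) Y := by
  refine hθ.formLength_lie_le_of_sSup hc (cartanK θ) (fun r X hX ↦ ?_) hX Y
  have h : θ X = X := hX
  change θ (r • X) = r • X
  rw [map_smul, h]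

omit hθ in
lemma formOpNorm_nonneg (Q : LinearMap.BilinForm ℝ L) (f : Module.End ℝ L) :
    0 ≤ formOpNorm Q f := by
  refine Real.sSup_nonneg ?_
  rintro r ⟨X, -, rfl⟩
  exact Real.sqrt_nonneg _

omit hθ in
lemma constC1_nonneg (θ : L →ₗ⁅ℝ⁆ L) (Q : LinearMap.BilinForm ℝ L) : 0 ≤ constC1 θ Q := by
  refine Real.sSup_nonneg ?_
  rintro r ⟨X, -, -, rfl⟩
  exact formOpNorm_nonneg _ _

end IsCartanInvolution

/-- The Levi-Civita connection on left-invariant fields: the product `∇_X Y` on the Lie algebra. -/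
noncomputable def leviCivitaProduct (θ : L →ₗ⁅ℝ⁆ L) : L →ₗ[ℝ] L →ₗ[ℝ] L :=
  LinearMap.mk₂ ℝ (fun X Y ↦ (1 / 2 : ℝ) • (⁅X, Y⁆ + ⁅θ Y, X⁆ + ⁅θ X, Y⁆))
    (by intros; simp only [add_lie, lie_add, map_add]; module)
    (by intros; simp only [smul_lie, lie_smul, map_smul]; module)
    (by intros; simp only [add_lie, lie_add, map_add]; module)
    (by intros; simp only [smul_lie, lie_smul, map_smul]; module)

lemma leviCivitaProduct_apply (θ : L →ₗ⁅ℝ⁆ L) (X Y : L) :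
    leviCivitaProduct θ X Y = (1 / 2 : ℝ) • (⁅X, Y⁆ + ⁅θ Y, X⁆ + ⁅θ X, Y⁆) := rfl

lemma leviCivitaProduct_sub_swap (θ : L →ₗ⁅ℝ⁆ L) (X Y : L) :
    leviCivitaProduct θ X Y - leviCivitaProduct θ Y X = ⁅X, Y⁆ := by
  rw [leviCivitaProduct_apply, leviCivitaProduct_apply, ← lie_skew X Y]
  module

/-- The curvature of a product `∇` on a Lie algebra. -/
noncomputable def productCurvature (D : L →ₗ[ℝ] L →ₗ[ℝ] L) (X Y Z : L) : L :=
  D X (D Y Z) - D Y (D X Z) - D ⁅X, Y⁆ Z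

namespace IsCartanInvolution

variable {θ : L →ₗ⁅ℝ⁆ L} (hθ : IsCartanInvolution θ)

include hθ

lemma leviCivitaProduct_skew (c : ℝ) (X Y Z : L) :
    canonicalForm c θ (leviCivitaProduct θ X Y) Z =
      -canonicalForm c θ Y (leviCivitaProduct θ X Z) := by
  have e1 := hθ.canonicalForm_lie_left c X Y Z
  have e2 := hθ.canonicalForm_lie_left c (θ X) Y Z
  have e3 := hθ.canonicalForm_lie_left c (θ Y) X Z
  have e4 := hθ.canonicalForm_lie_left c (θ Z) X Y
  rw [hθ.involutive] at e2 e3 e4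
  have e5 : ⁅Y, Z⁆ = -⁅Z, Y⁆ := (lie_skew _ _).symm
  have e6 := hθ.canonicalForm_symm c Y ⁅θ Z, X⁆
  rw [e5, map_neg] at e3
  simp only [leviCivitaProduct_apply, map_smul, map_add, LinearMap.smul_apply, LinearMap.add_apply,
    smul_eq_mul]
  linarith

/-- A torsion free product which is skew for the canonical form is the Levi-Civita product. -/
lemma eq_leviCivitaProduct {c : ℝ} (hc : 0 < c) (D : L → L → L)
    (htor : ∀ X Y, D X Y - D Y X = ⁅X, Y⁆)
    (hskew : ∀ X Y Z, canonicalForm c θ (D X Y) Z + canonicalForm c θ Y (D X Z) = 0) (X Y : L) :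
    D X Y = leviCivitaProduct θ X Y := by
  have key : ∀ Z, canonicalForm c θ (D X Y - leviCivitaProduct θ X Y) Z = 0 := by
    intro Z
    -- Koszul's argument: three torsion identities and three skewness identities determine `⟨D X Y,
    -- Z⟩`. The transposes of `ad X` and `ad Y` then move `Z` out of the brackets.
    have t1 := congrArg (canonicalForm c θ Z) (htor X Y)
    have t2 := congrArg (canonicalForm c θ X) (htor Y Z)
    have t3 := congrArg (canonicalForm c θ Y) (htor X Z)
    simp only [map_sub] at t1 t2 t3
    have s1 := hskew X Y Z
    have s2 := hskew Y X Z
    have s3 := hskew Z X Y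
    have c1 := hθ.canonicalForm_symm c (D X Y) Z
    have c2 := hθ.canonicalForm_symm c (D Y X) Z
    have c3 := hθ.canonicalForm_symm c (D Z X) Y
    have e1 := hθ.canonicalForm_symm c Z ⁅X, Y⁆
    have e2 := hθ.canonicalForm_lie_left c (θ Y) X Z
    have e3 := hθ.canonicalForm_lie_left c (θ X) Y Z
    rw [hθ.involutive] at e2 e3
    simp only [leviCivitaProduct_apply, map_sub, LinearMap.sub_apply, map_smul, map_add,
      LinearMap.smul_apply, LinearMap.add_apply, smul_eq_mul]
    linarith
  by_contra h
  exact (hθ.canonicalForm_pos hc (sub_ne_zero.2 h)).ne' (key _)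

/-- The curvature of the Levi-Civita product in terms of the Cartan components of the vectors. -/
lemma canonicalForm_productCurvature (c : ℝ) {a b u v : L} (ha : a ∈ cartanK θ)
    (hb : b ∈ cartanK θ) (hu : u ∈ cartanP θ) (hv : v ∈ cartanP θ) :
    canonicalForm c θ (productCurvature (leviCivitaProduct θ) (a + u) (b + v) (b + v)) (a + u) =
      1 / 4 * canonicalForm c θ (⁅a, v⁆ + ⁅u, b⁆) (⁅a, v⁆ + ⁅u, b⁆) +
      1 / 4 * canonicalForm c θ ⁅a, b⁆ ⁅a, b⁆ + 5 / 2 * canonicalForm c θ ⁅a, b⁆ ⁅u, v⁆ -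
      7 / 4 * canonicalForm c θ ⁅u, v⁆ ⁅u, v⁆ := by
  set Q := canonicalForm c θ with hQ
  set D := leviCivitaProduct θ with hD
  have ha' : θ a = a := ha
  have hb' : θ b = b := hb
  have hu' : θ u = -u := hu
  have hv' : θ v = -v := hv
  obtain ⟨A, hA⟩ : ∃ A, A = ⁅a, b⁆ := ⟨_, rfl⟩
  obtain ⟨U, hU⟩ : ∃ U, U = ⁅u, v⁆ := ⟨_, rfl⟩
  obtain ⟨P, hP⟩ : ∃ P, P = ⁅a, v⁆ := ⟨_, rfl⟩
  obtain ⟨S, hS⟩ : ∃ S, S = ⁅u, b⁆ := ⟨_, rfl⟩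
  obtain ⟨E, hE⟩ : ∃ E, E = ⁅a, u⁆ := ⟨_, rfl⟩
  obtain ⟨F, hF⟩ : ∃ F, F = ⁅b, v⁆ := ⟨_, rfl⟩
  have hba : ⁅b, a⁆ = -A := by rw [hA, lie_skew]
  have hvu : ⁅v, u⁆ = -U := by rw [hU, lie_skew]
  have hva : ⁅v, a⁆ = -P := by rw [hP, lie_skew]
  have hbu : ⁅b, u⁆ = -S := by rw [hS, lie_skew]
  have hua : ⁅u, a⁆ = -E := by rw [hE, lie_skew]
  have hvb : ⁅v, b⁆ = -F := by rw [hF, lie_skew]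
  have kA : A ∈ cartanK θ := by simp [cartanK, hA, ha', hb']
  have kU : U ∈ cartanK θ := by simp [cartanK, hU, hu', hv']
  have pP : P ∈ cartanP θ := by simp [cartanP, hP, ha', hv']
  have pS : S ∈ cartanP θ := by simp [cartanP, hS, hu', hb']
  have oAP := hθ.canonicalForm_orthogonal c kA pP
  have oAS := hθ.canonicalForm_orthogonal c kA pS
  have oUP := hθ.canonicalForm_orthogonal c kU pP
  have oUS := hθ.canonicalForm_orthogonal c kU pS
  -- The term `⟨∇_Y Y, ∇_X X⟩ = 4⟨F, E⟩` has no place in the final formula; the Jacobi identity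
  -- trades it for `⟨A, U⟩` and `⟨P, S⟩`.
  have jac : Q A U = -Q F E - Q P S := by
    have e1 : Q U A = Q v ⁅u, A⁆ := by
      rw [hU, hθ.canonicalForm_lie_left, hu', neg_lie, map_neg, neg_neg]
    have e2 : ⁅u, A⁆ = -⁅b, ⁅u, a⁆⁆ + ⁅a, ⁅u, b⁆⁆ := by
      rw [hA, leibniz_lie, lie_skew]
    have e3 : Q F E = -Q v ⁅b, E⁆ := by
      rw [hF, hθ.canonicalForm_lie_left, hb']
    have e4 : Q P S = -Q v ⁅a, S⁆ := by
      rw [hP, hθ.canonicalForm_lie_left, ha']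
    rw [e2, hua, ← hS, map_add, lie_neg, neg_neg] at e1
    linarith [hθ.canonicalForm_symm c A U]
  have dXX : D (a + u) (a + u) = (2 : ℝ) • E := by
    rw [hD, leviCivitaProduct_apply]
    simp only [map_add, ha', hu', add_lie, lie_add, neg_lie, lie_self,
      hua, ← hE]
    module
  have dYY : D (b + v) (b + v) = (2 : ℝ) • F := by
    rw [hD, leviCivitaProduct_apply]
    simp only [map_add, hb', hv', add_lie, lie_add, neg_lie, lie_self,
      hvb, ← hF]
    module
  have dXY : D (a + u) (b + v) =
      (1 / 2 : ℝ) • A + (1 / 2 : ℝ) • U + (3 / 2 : ℝ) • P - (1 / 2 : ℝ) • S := by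
    rw [hD, leviCivitaProduct_apply]
    simp only [map_add, ha', hu', hb', hv', add_lie, lie_add, neg_lie,
      hba, hvu, hva, hbu, ← hA, ← hU, ← hP, ← hS]
    module
  have dYX : D (b + v) (a + u) =
      -((1 / 2 : ℝ) • A) - (1 / 2 : ℝ) • U - (3 / 2 : ℝ) • S + (1 / 2 : ℝ) • P := by
    rw [hD, leviCivitaProduct_apply]
    simp only [map_add, ha', hu', hb', hv', add_lie, lie_add, neg_lie,
      hba, hvu, hva, hbu, ← hA, ← hU, ← hP, ← hS]
    module
  have hXY : ⁅a + u, b + v⁆ = A + U + P + S := by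
    simp only [add_lie, lie_add, ← hA, ← hU, ← hP, ← hS]
    abel
  obtain ⟨X, hX⟩ : ∃ X, X = a + u := ⟨_, rfl⟩
  obtain ⟨Y, hY⟩ : ∃ Y, Y = b + v := ⟨_, rfl⟩
  have hYX : ⁅Y, X⁆ = -⁅X, Y⁆ := (lie_skew _ _).symm
  -- Transposing each `ad` isolates `[X, Y]` in one slot, so that no iterated bracket has to be
  -- computed.
  have dZ : Q (D ⁅X, Y⁆ Y) X = -(1 / 2) *
      Q ⁅X, Y⁆ (-⁅θ Y, X⁆ + ⁅Y, X⁆ + ⁅θ X, Y⁆) := by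
    set Z := ⁅X, Y⁆ with hZ
    have f1 : Q ⁅Z, Y⁆ X = Q Z ⁅θ Y, X⁆ := by
      rw [← lie_skew, map_neg, LinearMap.neg_apply, hθ.canonicalForm_lie_left, neg_neg]
    have f2 : Q ⁅θ Y, Z⁆ X = -Q Z ⁅Y, X⁆ := by
      rw [hθ.canonicalForm_lie_left, hθ.involutive]
    have f3 : Q ⁅θ Z, Y⁆ X = -Q Z ⁅θ X, Y⁆ := by
      rw [hθ.canonicalForm_lie_left, hθ.involutive, hθ.canonicalForm_symm, ← lie_skew, map_neg,
        LinearMap.neg_apply, neg_neg, hθ.canonicalForm_lie_left]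
    simp only [hD, leviCivitaProduct_apply, map_smul, map_add, LinearMap.smul_apply,
      LinearMap.add_apply, smul_eq_mul, f1, f2, f3, map_neg]
    ring
  have hθYX : ⁅θ (b + v), a + u⁆ = -A + U - S + P := by
    simp only [map_add, hb', hv', add_lie, lie_add, neg_lie, hba, hvu, hva, hbu]
    abel
  have hθXY : ⁅θ (a + u), b + v⁆ = A - U + P - S := by
    simp only [map_add, ha', hu', add_lie, lie_add, neg_lie, ← hA, ← hU, ← hP, ← hS]
    abel
  -- Skewness of `∇_X` and `∇_Y` shifts the outer derivative onto `X`, leaving only first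
  -- derivatives.
  have expand : Q (productCurvature D X Y Y) X =
      -Q (D Y Y) (D X X) + Q (D X Y) (D Y X) - Q (D ⁅X, Y⁆ Y) X := by
    simp only [productCurvature, map_sub, LinearMap.sub_apply]
    rw [hθ.leviCivitaProduct_skew c X (D Y Y) X, hθ.leviCivitaProduct_skew c Y (D X Y) X]
    ring
  rw [← hX, ← hY, expand, dZ, hYX, hX, hY, dXX, dYY, dXY, dYX, hXY, hθYX, hθXY, ← hA, ← hU, ← hP,
    ← hS]
  simp only [map_add, map_sub, map_neg, map_smul, LinearMap.add_apply, LinearMap.sub_apply,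
    LinearMap.smul_apply, smul_eq_mul]
  have sUA := hθ.canonicalForm_symm c U A
  have sPA := hθ.canonicalForm_symm c P A
  have sSA := hθ.canonicalForm_symm c S A
  have sPU := hθ.canonicalForm_symm c P U
  have sSU := hθ.canonicalForm_symm c S U
  have sSP := hθ.canonicalForm_symm c S P
  simp only [← hQ] at *
  rw [sUA, sPA, sSA, sPU, sSU, sSP, oAP, oAS, oUP, oUS]
  linarith

end IsCartanInvolution

end CartanAlgebra

/-! ### The curvature estimate on the Lie algebra. -/

/-- Here `x, s` are the lengths of the `𝔨` and `𝔭` parts of `X`, and `y, w` those of `Y`; `M` is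
`|[a,v]+[u,b]|²`, `A` is `|[a,b]|` and `U` is `|[u,v]|`. Hypothesis `hk2` is the discriminant
condition for the quadratic form in `e6`. -/
lemma curvature_bound_of_component_bounds {k α C x y s w M A U : ℝ} (hk : 1 / 2 ≤ k)
    (hk1 : α ^ 2 / 4 < k)
    (hk2 : (2 * k - 1 - 5 / 2 * α) ^ 2 ≤ 4 * (k - α ^ 2 / 4) * (k + 7 / 4))
    (hC : 0 ≤ C) (hx : 0 ≤ x) (hy : 0 ≤ y)
    (hA : 0 ≤ A) (hU : 0 ≤ U)
    (hM1 : M ≤ (C * (x * w + s * y)) ^ 2) (hA1 : A ≤ α * C * (x * y)) (hU1 : U ≤ C * (s * w)) :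
    1 / 4 * M + 1 / 4 * A ^ 2 + 5 / 2 * (A * U) - 7 / 4 * U ^ 2 ≤
      k * C ^ 2 * ((x ^ 2 + s ^ 2) * (y ^ 2 + w ^ 2)) := by
  have hA2 : A ^ 2 ≤ (α * C * (x * y)) ^ 2 := by gcongr
  have hAU : A * U ≤ α * C * (x * y) * U := by gcongr
  obtain ⟨A₀, hA₀⟩ : ∃ A₀, A₀ = C * (x * y) := ⟨_, rfl⟩
  obtain ⟨B, hB⟩ : ∃ B, B = C * (s * w) := ⟨_, rfl⟩
  have hA₀0 : 0 ≤ A₀ := by rw [hA₀]; positivity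
  have e0 : α * C * (x * y) = α * A₀ := by rw [hA₀]; ring
  rw [e0] at hA2 hAU
  rw [← hB] at hU1
  -- The two-square identity `(x²+s²)(y²+w²) = (xw+sy)² + (xy-sw)²`: the first square absorbs `M`,
  -- and the second is left to control `A` and `U`.
  have e1 : C ^ 2 * ((x ^ 2 + s ^ 2) * (y ^ 2 + w ^ 2)) =
      (C * (x * w + s * y)) ^ 2 + (A₀ - B) ^ 2 := by rw [hA₀, hB]; ring
  have e2 : 4 * (A₀ * B) ≤ (C * (x * w + s * y)) ^ 2 := by
    have : 0 ≤ (C * (x * w - s * y)) ^ 2 := sq_nonneg _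
    rw [hA₀, hB]
    linarith
  rw [mul_assoc k, e1]
  set T := (C * (x * w + s * y)) ^ 2
  -- The difference of the two sides is at least the sum of `e3` to `e6`: `e3` replaces `T` by its
  -- lower bound `4A₀B`, `e4` and `e5` replace `B` by `U ≤ B`, and `e6` is the remaining form in
  -- `A₀` and `U`.
  have e3 : 0 ≤ (k - 1 / 4) * (T - 4 * (A₀ * B)) :=
    mul_nonneg (by linarith) (by linarith)
  have e4 : 0 ≤ (2 * k - 1) * (A₀ * (B - U)) :=
    mul_nonneg (by linarith) (mul_nonneg hA₀0 (by linarith))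
  have e5 : 0 ≤ k * (B ^ 2 - U ^ 2) :=
    mul_nonneg (by linarith) (by nlinarith)
  have e6 : 0 ≤ (k - α ^ 2 / 4) * A₀ ^ 2 + (2 * k - 1 - 5 / 2 * α) * (A₀ * U) +
      (k + 7 / 4) * U ^ 2 := by
    have hp : 0 < k - α ^ 2 / 4 := by linarith
    have h1 : 0 ≤ (2 * (k - α ^ 2 / 4) * A₀ + (2 * k - 1 - 5 / 2 * α) * U) ^ 2 +
        (4 * (k - α ^ 2 / 4) * (k + 7 / 4) - (2 * k - 1 - 5 / 2 * α) ^ 2) * U ^ 2 :=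
      add_nonneg (sq_nonneg _) (mul_nonneg (by linarith) (sq_nonneg _))
    have h2 : 0 ≤ 4 * (k - α ^ 2 / 4) * ((k - α ^ 2 / 4) * A₀ ^ 2 +
        (2 * k - 1 - 5 / 2 * α) * (A₀ * U) + (k + 7 / 4) * U ^ 2) := by
      linarith
    exact nonneg_of_mul_nonneg_right h2 (by linarith)
  linarith

namespace IsCartanInvolution

variable {L : Type*} [LieRing L] [LieAlgebra ℝ L] {θ : L →ₗ⁅ℝ⁆ L} (hθ : IsCartanInvolution θ)

include hθ

lemma canonicalForm_le_formLength_mul {c : ℝ} (hc : 0 < c) (X Y : L) :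
    canonicalForm c θ X Y ≤ formLength (canonicalForm c θ) X * formLength (canonicalForm c θ) Y := by
  refine le_of_sq_le_sq ?_ (mul_nonneg (Real.sqrt_nonneg _) (Real.sqrt_nonneg _))
  rw [mul_pow, hθ.formLength_sq hc, hθ.formLength_sq hc]
  exact LinearMap.BilinForm.apply_sq_le_of_symm _ (hθ.canonicalForm_self_nonneg hc)
    ⟨hθ.canonicalForm_symm c⟩ X Y

lemma exists_cartan_decomposition (X : L) : ∃ a ∈ cartanK θ, ∃ u ∈ cartanP θ, X = a + u := by
  refine ⟨(1 / 2 : ℝ) • (X + θ X), ?_, (1 / 2 : ℝ) • (X - θ X), ?_, by module⟩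
  · change θ _ = _
    rw [map_smul, map_add, hθ.involutive, add_comm]
  · change θ _ = _
    rw [map_smul, map_sub, hθ.involutive]
    module

lemma canonicalForm_add_self (c : ℝ) {a u : L} (ha : a ∈ cartanK θ) (hu : u ∈ cartanP θ) :
    canonicalForm c θ (a + u) (a + u) = canonicalForm c θ a a + canonicalForm c θ u u := by
  have h1 := hθ.canonicalForm_orthogonal c ha hu
  have h2 := hθ.canonicalForm_symm c u a
  simp only [map_add, LinearMap.add_apply]
  linarith

/-- The numerator of the sectional curvature only depends on `Y` modulo `X`. -/
lemma canonicalForm_productCurvature_add_smul (c r : ℝ) (X Y : L) :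
    canonicalForm c θ (productCurvature (leviCivitaProduct θ) X (Y + r • X) (Y + r • X)) X =
      canonicalForm c θ (productCurvature (leviCivitaProduct θ) X Y Y) X := by
  obtain ⟨a, ha, u, hu, rfl⟩ := hθ.exists_cartan_decomposition X
  obtain ⟨b, hb, v, hv, rfl⟩ := hθ.exists_cartan_decomposition Y
  have hb' : b + r • a ∈ cartanK θ := by
    have h1 : θ a = a := ha
    have h2 : θ b = b := hb
    simp [cartanK, h1, h2]
  have hv' : v + r • u ∈ cartanP θ := by
    have h1 : θ u = -u := hu
    have h2 : θ v = -v := hv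
    simp [cartanP, h1, h2, add_comm]
  -- The curvature formula sees `Y` only through `[a,b]`, `[u,v]` and `[a,v]+[u,b]`. In the last one
  -- the new terms `r[a,u]` and `r[u,a]` cancel.
  have e : b + v + r • (a + u) = (b + r • a) + (v + r • u) := by module
  have e1 : ⁅a, b + r • a⁆ = ⁅a, b⁆ := by simp
  have e2 : ⁅u, v + r • u⁆ = ⁅u, v⁆ := by simp
  have e3 : ⁅a, v + r • u⁆ + ⁅u, b + r • a⁆ = ⁅a, v⁆ + ⁅u, b⁆ := by
    rw [lie_add, lie_add, lie_smul, lie_smul, ← lie_skew a u]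
    module
  rw [e, hθ.canonicalForm_productCurvature c ha hb' hu hv',
    hθ.canonicalForm_productCurvature c ha hb hu hv, e1, e2, e3]

variable [FiniteDimensional ℝ L]

lemma canonicalForm_productCurvature_le {c : ℝ} (hc : 0 < c) {k α : ℝ} (hk : 1 / 2 ≤ k)
    (hk1 : α ^ 2 / 4 < k)
    (hk2 : (2 * k - 1 - 5 / 2 * α) ^ 2 ≤ 4 * (k - α ^ 2 / 4) * (k + 7 / 4))
    (hα : constC2 θ (canonicalForm c θ) = α * constC1 θ (canonicalForm c θ)) (X Y : L) :
    canonicalForm c θ (productCurvature (leviCivitaProduct θ) X Y Y) X ≤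
      k * constC1 θ (canonicalForm c θ) ^ 2 *
        (canonicalForm c θ X X * canonicalForm c θ Y Y) := by
  obtain ⟨a, ha, u, hu, rfl⟩ := hθ.exists_cartan_decomposition X
  obtain ⟨b, hb, v, hv, rfl⟩ := hθ.exists_cartan_decomposition Y
  rw [hθ.canonicalForm_productCurvature c ha hb hu hv, hθ.canonicalForm_add_self c ha hu,
    hθ.canonicalForm_add_self c hb hv]
  have hab := hθ.formLength_lie_le_constC2 hc ha b
  have huv := hθ.formLength_lie_le_constC1 hc hu v
  have hub := hθ.formLength_lie_le_constC1 hc hu b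
  -- A mixed bracket is bounded through its `𝔭` factor: the norm of `ad v` is a supremum over all of
  -- `𝔤`, so `C₁` suffices.
  have hva := hθ.formLength_lie_le_constC1 hc hv a
  have hC := constC1_nonneg θ (canonicalForm c θ)
  have hAU := hθ.canonicalForm_le_formLength_mul hc ⁅a, b⁆ ⁅u, v⁆
  have hPS := hθ.canonicalForm_le_formLength_mul hc ⁅a, v⁆ ⁅u, b⁆
  have hSP := hθ.canonicalForm_symm c ⁅u, b⁆ ⁅a, v⁆
  have hav : formLength (canonicalForm c θ) ⁅a, v⁆ = formLength (canonicalForm c θ) ⁅v, a⁆ := by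
    rw [← lie_skew, ← neg_one_smul ℝ, formLength_smul]
    simp
  rw [← hav] at hva
  rw [hα] at hab
  set C := constC1 θ (canonicalForm c θ)
  have nn : ∀ Z : L, 0 ≤ formLength (canonicalForm c θ) Z := fun Z ↦ Real.sqrt_nonneg _
  have hM : canonicalForm c θ (⁅a, v⁆ + ⁅u, b⁆) (⁅a, v⁆ + ⁅u, b⁆) ≤
      (C * (formLength (canonicalForm c θ) a * formLength (canonicalForm c θ) v +
        formLength (canonicalForm c θ) u * formLength (canonicalForm c θ) b)) ^ 2 := by
    calc _ ≤ (formLength (canonicalForm c θ) ⁅a, v⁆ + formLength (canonicalForm c θ) ⁅u, b⁆) ^ 2 := by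
          simp only [map_add, LinearMap.add_apply, add_sq, hθ.formLength_sq hc]
          linarith
      _ ≤ _ := by
          have h1 := nn ⁅a, v⁆
          have h2 := nn ⁅u, b⁆
          gcongr
          linarith
  have key := curvature_bound_of_component_bounds hk hk1 hk2 hC (nn a) (nn b)
    (nn ⁅a, b⁆) (nn ⁅u, v⁆) hM (by rwa [← mul_assoc]) (by rwa [← mul_assoc])
  simp only [hθ.formLength_sq hc] at key
  linarith

lemma canonicalForm_productCurvature_div_le {c : ℝ} (hc : 0 < c) {k α : ℝ} (hk : 1 / 2 ≤ k)
    (hk1 : α ^ 2 / 4 < k)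
    (hk2 : (2 * k - 1 - 5 / 2 * α) ^ 2 ≤ 4 * (k - α ^ 2 / 4) * (k + 7 / 4))
    (hα : constC2 θ (canonicalForm c θ) = α * constC1 θ (canonicalForm c θ)) {X Y : L}
    (hXY : LinearIndependent ℝ ![X, Y]) :
    canonicalForm c θ (productCurvature (leviCivitaProduct θ) X Y Y) X /
        (canonicalForm c θ X X * canonicalForm c θ Y Y - canonicalForm c θ X Y ^ 2) ≤
      k * constC1 θ (canonicalForm c θ) ^ 2 := by
  have hX : X ≠ 0 := by simpa using hXY.ne_zero 0
  have hX0 := hθ.canonicalForm_pos hc hX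
  -- Gram–Schmidt: the previous bound is against `|X|²|Y|²`, which equals the Gram determinant only
  -- for orthogonal vectors.
  set r := -(canonicalForm c θ X Y / canonicalForm c θ X X) with hr
  have hY' : Y + r • X ≠ 0 := by
    intro h
    have := LinearIndependent.pair_iff.1 hXY r 1 (by rw [one_smul, add_comm]; exact h)
    exact one_ne_zero this.2
  have e : canonicalForm c θ X X * canonicalForm c θ Y Y - canonicalForm c θ X Y ^ 2 =
      canonicalForm c θ X X * canonicalForm c θ (Y + r • X) (Y + r • X) := by
    simp only [map_add, map_smul, LinearMap.add_apply, LinearMap.smul_apply, smul_eq_mul,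
      hθ.canonicalForm_symm c Y X, hr]
    field_simp
    ring
  rw [e, div_le_iff₀ (mul_pos hX0 (hθ.canonicalForm_pos hc hY')),
    ← hθ.canonicalForm_productCurvature_add_smul c r]
  exact hθ.canonicalForm_productCurvature_le hc hk hk1 hk2 hα _ _

end IsCartanInvolution

/-! ### The left trivialization of the tangent bundle. -/

section LeftTrivialization

variable {n : ℕ} {G : Type*} [TopologicalSpace G] [ChartedSpace (EuclideanSpace ℝ (Fin n)) G]
  [Group G]

/-- The left trivialization of the tangent bundle: the differential at `x` of left translation
by `x⁻¹`. -/
noncomputable def leftTriv (x : G) : TangentSpace (𝓡 n) x →ₗ[ℝ] GroupLieAlgebra (𝓡 n) G :=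
  (mfderiv (𝓡 n) (𝓡 n) (fun y : G ↦ x⁻¹ * y) x).toLinearMap

lemma leftInvariantMetric_apply (Q : LinearMap.BilinForm ℝ (GroupLieAlgebra (𝓡 n) G)) (x : G)
    (v w : TangentSpace (𝓡 n) x) :
    leftInvariantMetric Q x v w = Q (leftTriv x v) (leftTriv x w) := rfl

variable [LieGroup (𝓡 n) ∞ G]

lemma mdifferentiableAt_leftMul (a x : G) :
    MDifferentiableAt (𝓡 n) (𝓡 n) (fun y : G ↦ a * y) x :=
  (contMDiff_mul_left (I := 𝓡 n) (n := ∞)).contMDiffAt.mdifferentiableAt (by simp)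

lemma leftTriv_mulInvariantVectorField (x : G) (v : GroupLieAlgebra (𝓡 n) G) :
    leftTriv x (mulInvariantVectorField v x) = v := by
  have h := mfderiv_comp_apply_of_eq (I := 𝓡 n) (I' := 𝓡 n) (I'' := 𝓡 n) (f := fun y : G ↦ x * y)
    (g := fun y : G ↦ x⁻¹ * y) (y := x) 1 (mdifferentiableAt_leftMul x⁻¹ x)
    (mdifferentiableAt_leftMul x 1) (mul_one x) v
  have e : (fun y : G ↦ x⁻¹ * y) ∘ (fun y : G ↦ x * y) = id := by ext; simp
  rw [e, mfderiv_id] at h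
  have e2 : x * 1 = x := mul_one x
  rw [e2] at h
  exact h.symm

lemma mulInvariantVectorField_leftTriv (x : G) (v : TangentSpace (𝓡 n) x) :
    mulInvariantVectorField (leftTriv x v) x = v := by
  have h := mfderiv_comp_apply_of_eq (I := 𝓡 n) (I' := 𝓡 n) (I'' := 𝓡 n)
    (f := fun y : G ↦ x⁻¹ * y) (g := fun y : G ↦ x * y) (y := 1) x (mdifferentiableAt_leftMul x 1)
    (mdifferentiableAt_leftMul x⁻¹ x) (inv_mul_cancel x) v
  have e : (fun y : G ↦ x * y) ∘ (fun y : G ↦ x⁻¹ * y) = id := by ext; simp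
  rw [e, mfderiv_id] at h
  have e2 : x⁻¹ * x = 1 := inv_mul_cancel x
  rw [e2] at h
  exact h.symm

lemma leftTriv_injective (x : G) : Function.Injective (leftTriv (n := n) x) :=
  Function.LeftInverse.injective (g := fun v ↦ mulInvariantVectorField v x)
    (mulInvariantVectorField_leftTriv x)

lemma contMDiff_invariant (v : GroupLieAlgebra (𝓡 n) G) :
    ContMDiff (𝓡 n) (𝓡 n).tangent 2
      (fun y : G ↦ (⟨y, mulInvariantVectorField v y⟩ : TangentBundle (𝓡 n) G)) :=
  (contMDiff_mulInvariantVectorField v).of_le le_minSmoothness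

lemma mdifferentiableAt_invariant (v : GroupLieAlgebra (𝓡 n) G) (x : G) :
    MDifferentiableAt (𝓡 n) (𝓡 n).tangent
      (fun y : G ↦ (⟨y, mulInvariantVectorField v y⟩ : TangentBundle (𝓡 n) G)) x :=
  mdifferentiableAt_mulInvariantVectorField v

/-- The coordinates of a smooth vector field in the left trivialization are smooth. -/
lemma contMDiff_leftTriv (φ : GroupLieAlgebra (𝓡 n) G →ₗ[ℝ] ℝ) {X : ∀ y : G, TangentSpace (𝓡 n) y}
    (hX : ContMDiff (𝓡 n) (𝓡 n).tangent ∞ (fun y ↦ (⟨y, X y⟩ : TangentBundle (𝓡 n) G))) :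
    ContMDiff (𝓡 n) 𝓘(ℝ, ℝ) ∞ (fun y ↦ φ (leftTriv y (X y))) := by
  -- The trivialized field is the tangent map of the smooth map `(p, q) ↦ p⁻¹ * q` applied to `(0, X
  -- g)` at `(g, g)`: the zero in the first factor freezes `p = g`.
  let fg : G → TangentBundle (𝓡 n) G := fun g ↦ TotalSpace.mk' _ g 0
  have sfg : ContMDiff (𝓡 n) (𝓡 n).tangent ∞ fg := contMDiff_zeroSection _ _
  have S₁ : ContMDiff (𝓡 n) ((𝓡 n).tangent.prod (𝓡 n).tangent) ∞
    (fun g ↦ (fg g, (⟨g, X g⟩ : TangentBundle (𝓡 n) G))) := sfg.prodMk hX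
  have S₂ : ContMDiff ((𝓡 n).tangent.prod (𝓡 n).tangent) ((𝓡 n).prod (𝓡 n)).tangent ∞
      (equivTangentBundleProd (𝓡 n) G (𝓡 n) G).symm := contMDiff_equivTangentBundleProd_symm
  have hP : ContMDiff ((𝓡 n).prod (𝓡 n)) (𝓡 n) ∞ (fun p : G × G ↦ p.1⁻¹ * p.2) :=
    (contMDiff_fst.inv ).mul contMDiff_snd
  have S₃ : ContMDiff ((𝓡 n).prod (𝓡 n)).tangent (𝓡 n).tangent ∞
      (tangentMap ((𝓡 n).prod (𝓡 n)) (𝓡 n) (fun p : G × G ↦ p.1⁻¹ * p.2)) :=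
    hP.contMDiff_tangentMap (by simp)
  have S := (S₃.comp S₂).comp S₁
  have e : (tangentMap ((𝓡 n).prod (𝓡 n)) (𝓡 n) (fun p : G × G ↦ p.1⁻¹ * p.2) ∘
      (equivTangentBundleProd (𝓡 n) G (𝓡 n) G).symm) ∘
      (fun g ↦ (fg g, (⟨g, X g⟩ : TangentBundle (𝓡 n) G))) =
      fun g ↦ (⟨1, leftTriv g (X g)⟩ : TangentBundle (𝓡 n) G) := by
    ext1 g
    apply TotalSpace.ext
    · simp [fg]
    · let w : TangentSpace ((𝓡 n).prod (𝓡 n)) (g, g) :=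
        ((0 : TangentSpace (𝓡 n) g), X g)
      have h := mfderiv_prod_eq_add_apply (I := 𝓡 n) (I' := 𝓡 n) (I'' := 𝓡 n) (v := w)
        (hP.contMDiffAt.mdifferentiableAt (x := (g, g)) (by simp))
      have h0 : mfderiv (𝓡 n) (𝓡 n) (fun z : G ↦ z⁻¹ * g) g w.1 = 0 :=
        map_zero (mfderiv (𝓡 n) (𝓡 n) (fun z : G ↦ z⁻¹ * g) g)
      refine heq_of_eq (h.trans ?_)
      refine (congrArg (· + _) h0).trans (zero_add _)
  rw [e] at S
  let φ' : EuclideanSpace ℝ (Fin n) →L[ℝ] ℝ := LinearMap.toContinuousLinearMap φ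
  intro x
  have h := (contMDiffAt_totalSpace.1 (S x)).2
  refine (φ'.contMDiff.contMDiffAt.comp x h).congr_of_eventuallyEq
    (Filter.Eventually.of_forall fun y ↦ ?_)
  -- All values lie over the base point 1, where the trivialization centred at 1 is the identity on
  -- the fibre.
  refine congrArg φ' (?_ : _ = (trivializationAt _ _ (1 : G) ⟨1, leftTriv y (X y)⟩).2)
  rw [TangentBundle.trivializationAt_apply]
  exact (tangentCoordChange_self (mem_extChartAt_source (1 : G))).symm

end LeftTrivialization

/-! ### Covariant derivatives of left-invariant fields, and the bracket as a commutator. -/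

section LeviCivita

open VectorField

variable {n : ℕ} {G : Type*} [TopologicalSpace G] [ChartedSpace (EuclideanSpace ℝ (Fin n)) G]
  [Group G] [LieGroup (𝓡 n) ∞ G]

/-- Inner products of left-invariant fields are constant, so metric compatibility becomes skewness;
with zero torsion, `eq_leviCivitaProduct` applies. -/
lemma leftTriv_cov_invariant {θ : GroupLieAlgebra (𝓡 n) G →ₗ⁅ℝ⁆ GroupLieAlgebra (𝓡 n) G}
    (hθ : IsCartanInvolution θ) {c : ℝ} (hc : 0 < c) {cov : TangentConnection n G}
    (hcov : IsLeviCivita (leftInvariantMetric (canonicalForm c θ)) cov) (x : G)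
    (v : TangentSpace (𝓡 n) x) (W : GroupLieAlgebra (𝓡 n) G) :
    leftTriv x (cov (mulInvariantVectorField W) x v) = leviCivitaProduct θ (leftTriv x v) W := by
  have key := hθ.eq_leviCivitaProduct hc
    (fun V W ↦ leftTriv x (cov (mulInvariantVectorField W) x (mulInvariantVectorField V x))) ?_ ?_
    (leftTriv x v) W
  · rwa [mulInvariantVectorField_leftTriv] at key
  · intro V W
    have h := (CovariantDerivative.torsion_eq_zero_iff cov).1 hcov.torsion_free
      (mdifferentiableAt_invariant V x) (mdifferentiableAt_invariant W x)
    rw [← mulInvariantVector_mlieBracket] at h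
    have h2 := congrArg (leftTriv x) h
    rw [map_sub, leftTriv_mulInvariantVectorField] at h2
    exact h2
  · intro V W Z
    have h := hcov.metric x (mulInvariantVectorField V x) (mulInvariantVectorField W)
      (mulInvariantVectorField Z) (mdifferentiableAt_invariant W x) (mdifferentiableAt_invariant Z x)
    simp only [leftInvariantMetric_apply, leftTriv_mulInvariantVectorField, mvfderiv_const,
      zero_apply] at h
    exact h.symm

lemma cov_sum_smul (cov : TangentConnection n G) {κ : Type*} (s : Finset κ) (f : κ → G → ℝ)
    (σ : κ → ∀ y : G, TangentSpace (𝓡 n) y) (x : G)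
    (hf : ∀ i, MDifferentiableAt (𝓡 n) 𝓘(ℝ, ℝ) (f i) x)
    (hσ : ∀ i, MDifferentiableAt (𝓡 n) (𝓡 n).tangent
      (fun y ↦ (⟨y, σ i y⟩ : TangentBundle (𝓡 n) G)) x) (v : TangentSpace (𝓡 n) x) :
    cov (fun y ↦ ∑ i ∈ s, f i y • σ i y) x v =
      ∑ i ∈ s, (f i x • cov (σ i) x v + mvfderiv (𝓡 n) (f i) x v • σ i x) := by
  classical
  induction s using Finset.induction_on with
  | empty =>
    have h := cov.zero
    simp only [Finset.sum_empty]
    exact congrArg (fun F ↦ F x v) h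
  | insert i s hi ih =>
    have h1 : MDifferentiableAt (𝓡 n) (𝓡 n).tangent
        (fun y ↦ (⟨y, (f i • σ i) y⟩ : TangentBundle (𝓡 n) G)) x := (hf i).smul_section (hσ i)
    have h2 : MDifferentiableAt (𝓡 n) (𝓡 n).tangent
        (fun y ↦ (⟨y, ∑ i ∈ s, f i y • σ i y⟩ : TangentBundle (𝓡 n) G)) x :=
      MDifferentiableAt.sum_section (t := fun i ↦ f i • σ i)
        fun i _ ↦ (hf i).smul_section (hσ i)
    have h3 := cov.isCovariantDerivativeOnUniv.add h1 h2
    have e : (fun y ↦ ∑ j ∈ insert i s, f j y • σ j y) =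
        (f i • σ i) + fun y ↦ ∑ j ∈ s, f j y • σ j y := by
      ext1 y
      rw [Finset.sum_insert hi]
      rfl
    rw [e, h3, Finset.sum_insert hi, add_apply, ih,
      cov.isCovariantDerivativeOnUniv.leibniz (hσ i) (hf i)]
    rfl

lemma contMDiff_mvfderiv_apply {f : G → ℝ} (hf : ContMDiff (𝓡 n) 𝓘(ℝ, ℝ) ∞ f)
    {X : ∀ y : G, TangentSpace (𝓡 n) y}
    (hX : ContMDiff (𝓡 n) (𝓡 n).tangent ∞ (fun y ↦ (⟨y, X y⟩ : TangentBundle (𝓡 n) G))) :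
    ContMDiff (𝓡 n) 𝓘(ℝ, ℝ) ∞ (fun y ↦ mvfderiv (𝓡 n) f y (X y)) :=
  (contMDiff_snd_tangentBundle_modelSpace ℝ 𝓘(ℝ, ℝ)).comp
    ((hf.contMDiff_tangentMap (by simp)).comp hX)

/-- The bracket of vector fields is the commutator of derivations. -/
lemma mvfderiv_mlieBracket {f : G → ℝ} (hf : ContMDiff (𝓡 n) 𝓘(ℝ, ℝ) ∞ f)
    {X Y : ∀ y : G, TangentSpace (𝓡 n) y}
    (hX : ContMDiff (𝓡 n) (𝓡 n).tangent ∞ (fun y ↦ (⟨y, X y⟩ : TangentBundle (𝓡 n) G)))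
    (hY : ContMDiff (𝓡 n) (𝓡 n).tangent ∞ (fun y ↦ (⟨y, Y y⟩ : TangentBundle (𝓡 n) G))) (x : G) :
    mvfderiv (𝓡 n) f x (mlieBracket (𝓡 n) X Y x) =
      mvfderiv (𝓡 n) (fun y ↦ mvfderiv (𝓡 n) f y (Y y)) x (X x) -
        mvfderiv (𝓡 n) (fun y ↦ mvfderiv (𝓡 n) f y (X y)) x (Y x) := by
  rcases subsingleton_or_nontrivial (GroupLieAlgebra (𝓡 n) G) with hs | hs
  -- In dimension zero there is no nonvanishing field `W` to test against, but both sides vanish.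
  · have h0 : ∀ v : TangentSpace (𝓡 n) x, v = 0 := fun v ↦
      leftTriv_injective x (Subsingleton.elim _ _)
    rw [h0 (mlieBracket (𝓡 n) X Y x), h0 (X x), h0 (Y x)]
    simp
  obtain ⟨w, hw⟩ := exists_ne (0 : GroupLieAlgebra (𝓡 n) G)
  set W : ∀ y : G, TangentSpace (𝓡 n) y := mulInvariantVectorField w with hW
  have hWx : W x ≠ 0 := by
    intro h
    have := leftTriv_mulInvariantVectorField x w
    rw [← hW, h, map_zero] at this
    exact hw this.symm
  have two_le : (2 : WithTop ℕ∞) ≤ ∞ := ENat.LEInfty.out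
  have cW : ContMDiff (𝓡 n) (𝓡 n).tangent 2 (fun y ↦ (⟨y, W y⟩ : TangentBundle (𝓡 n) G)) :=
    contMDiff_invariant w
  have dW := cW.mdifferentiable (by simp)
  have df := hf.mdifferentiable (by simp)
  have cfW : ContMDiff (𝓡 n) (𝓡 n).tangent 2
      (fun y ↦ (⟨y, (f • W) y⟩ : TangentBundle (𝓡 n) G)) := (hf.of_le two_le).smul_section cW
  have bracket_diff : ∀ {Z : ∀ y : G, TangentSpace (𝓡 n) y},
      ContMDiff (𝓡 n) (𝓡 n).tangent ∞ (fun y ↦ (⟨y, Z y⟩ : TangentBundle (𝓡 n) G)) →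
      MDifferentiable (𝓡 n) (𝓡 n).tangent
        (fun y ↦ (⟨y, mlieBracket (𝓡 n) Z W y⟩ : TangentBundle (𝓡 n) G)) := by
    intro Z hZ y
    have : IsManifold (𝓡 n) ((2 : ℕ∞) + 1) G :=
      IsManifold.of_le (n := ∞) (WithTop.coe_le_coe.2 (le_top : (2 + 1 : ℕ∞) ≤ ⊤))
    have h : ContMDiffAt (𝓡 n) (𝓡 n).tangent ((1 : ℕ∞) : WithTop ℕ∞)
        (fun y ↦ (⟨y, mlieBracket (𝓡 n) Z W y⟩ : TangentBundle (𝓡 n) G)) y :=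
      ContMDiffAt.mlieBracket_vectorField (n := 2) ((hZ.of_le two_le).contMDiffAt) cW.contMDiffAt
        (by rw [minSmoothness_of_isRCLikeNormedField]; norm_num)
    exact h.mdifferentiableAt (by simp)
  have step : ∀ {Z Z' : ∀ y : G, TangentSpace (𝓡 n) y},
      ContMDiff (𝓡 n) (𝓡 n).tangent ∞ (fun y ↦ (⟨y, Z y⟩ : TangentBundle (𝓡 n) G)) →
      ContMDiff (𝓡 n) (𝓡 n).tangent ∞ (fun y ↦ (⟨y, Z' y⟩ : TangentBundle (𝓡 n) G)) →
      mlieBracket (𝓡 n) Z (mlieBracket (𝓡 n) Z' (f • W)) x =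
        mvfderiv (𝓡 n) (fun y ↦ mvfderiv (𝓡 n) f y (Z' y)) x (Z x) • W x +
        mvfderiv (𝓡 n) f x (Z' x) • mlieBracket (𝓡 n) Z W x +
        (mvfderiv (𝓡 n) f x (Z x) • mlieBracket (𝓡 n) Z' W x +
          f x • mlieBracket (𝓡 n) Z (mlieBracket (𝓡 n) Z' W) x) := by
    intro Z Z' hZ hZ'
    have d1 : MDifferentiable (𝓡 n) 𝓘(ℝ, ℝ) (fun y ↦ mvfderiv (𝓡 n) f y (Z' y)) :=
      (contMDiff_mvfderiv_apply hf hZ').mdifferentiable (by simp)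
    have e : mlieBracket (𝓡 n) Z' (f • W) =
        (fun y ↦ mvfderiv (𝓡 n) f y (Z' y)) • W + f • mlieBracket (𝓡 n) Z' W := by
      ext1 y
      exact mlieBracket_smul_right (df y) (dW y)
    rw [e, mlieBracket_add_right, mlieBracket_smul_right (d1 x) (dW x),
      mlieBracket_smul_right (df x) (bracket_diff hZ' x)]
    · exact (d1 x).smul_section (dW x)
    · exact (df x).smul_section (bracket_diff hZ' x)
  have ms : minSmoothness ℝ 2 = 2 := minSmoothness_of_isRCLikeNormedField
  have J : ∀ {V : ∀ y : G, TangentSpace (𝓡 n) y},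
      ContMDiff (𝓡 n) (𝓡 n).tangent 2 (fun y ↦ (⟨y, V y⟩ : TangentBundle (𝓡 n) G)) →
      mlieBracket (𝓡 n) X (mlieBracket (𝓡 n) Y V) x =
        mlieBracket (𝓡 n) (mlieBracket (𝓡 n) X Y) V x +
          mlieBracket (𝓡 n) Y (mlieBracket (𝓡 n) X V) x := by
    intro V hV
    apply leibniz_identity_mlieBracket_apply <;> rw [ms]
    · exact (hX.of_le two_le).contMDiffAt
    · exact (hY.of_le two_le).contMDiffAt
    · exact hV.contMDiffAt
  -- Comparing the Jacobi identity for `f • W` with `f` times the one for `W`, only second-order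
  -- derivatives of `f` and the derivative along `[X, Y]` survive, as coefficients of `W x ≠ 0`.
  have J1 := J cfW
  have J2 := J cW
  rw [step hX hY, step hY hX, mlieBracket_smul_right (df x) (dW x), J2] at J1
  have J3 : (mvfderiv (𝓡 n) f x (mlieBracket (𝓡 n) X Y x) -
      (mvfderiv (𝓡 n) (fun y ↦ mvfderiv (𝓡 n) f y (Y y)) x (X x) -
        mvfderiv (𝓡 n) (fun y ↦ mvfderiv (𝓡 n) f y (X y)) x (Y x))) • W x = 0 := by
    rw [← sub_eq_zero] at J1
    rw [← neg_eq_zero, ← J1]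
    module
  exact sub_eq_zero.1 ((smul_eq_zero.1 J3).resolve_right hWx)

end LeviCivita

/-! ### Curvature of arbitrary smooth fields in a left-invariant frame. -/

section Curvature

open VectorField

variable {n : ℕ} {G : Type*} [TopologicalSpace G] [ChartedSpace (EuclideanSpace ℝ (Fin n)) G]
  [Group G] [LieGroup (𝓡 n) ∞ G]

/-- The derivative of a vector field along `v`, in the left trivialization and a basis. -/
noncomputable def frameDeriv {ι : Type*} [Fintype ι]
    (b : Module.Basis ι ℝ (GroupLieAlgebra (𝓡 n) G)) (Z : ∀ y : G, TangentSpace (𝓡 n) y)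
    (x : G) (v : TangentSpace (𝓡 n) x) : GroupLieAlgebra (𝓡 n) G :=
  ∑ i, mvfderiv (𝓡 n) (fun y ↦ b.coord i (leftTriv y (Z y))) x v • b i

variable {ι : Type*} [Fintype ι] (b : Module.Basis ι ℝ (GroupLieAlgebra (𝓡 n) G))

lemma sum_coord_smul_mulInvariantVectorField (Z : ∀ y : G, TangentSpace (𝓡 n) y) (y : G) :
    Z y = ∑ i, b.coord i (leftTriv y (Z y)) • mulInvariantVectorField (b i) y := by
  apply leftTriv_injective y
  simp only [map_sum, map_smul, leftTriv_mulInvariantVectorField, Module.Basis.coord_apply,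
    b.sum_repr]

variable {cov : TangentConnection n G}
  {D : GroupLieAlgebra (𝓡 n) G →ₗ[ℝ] GroupLieAlgebra (𝓡 n) G →ₗ[ℝ] GroupLieAlgebra (𝓡 n) G}
  (hD : ∀ (x : G) (v : TangentSpace (𝓡 n) x) (W : GroupLieAlgebra (𝓡 n) G),
    leftTriv x (cov (mulInvariantVectorField W) x v) = D (leftTriv x v) W)

include hD

lemma leftTriv_cov_sum {κ : Type*} [Fintype κ] (f : κ → G → ℝ)
    (w : κ → GroupLieAlgebra (𝓡 n) G) (x : G)
    (hf : ∀ i, MDifferentiableAt (𝓡 n) 𝓘(ℝ, ℝ) (f i) x) (v : TangentSpace (𝓡 n) x) :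
    leftTriv x (cov (fun y ↦ ∑ i, f i y • mulInvariantVectorField (w i) y) x v) =
      ∑ i, (f i x • D (leftTriv x v) (w i) + mvfderiv (𝓡 n) (f i) x v • w i) := by
  rw [cov_sum_smul cov Finset.univ f (fun i ↦ mulInvariantVectorField (w i)) x hf
    fun i ↦ mdifferentiableAt_invariant (w i) x]
  simp only [map_sum, map_add, map_smul, hD, leftTriv_mulInvariantVectorField]

variable {X Y Z : ∀ y : G, TangentSpace (𝓡 n) y}
  (hX : ContMDiff (𝓡 n) (𝓡 n).tangent ∞ (fun y ↦ (⟨y, X y⟩ : TangentBundle (𝓡 n) G)))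
  (hY : ContMDiff (𝓡 n) (𝓡 n).tangent ∞ (fun y ↦ (⟨y, Y y⟩ : TangentBundle (𝓡 n) G)))
  (hZ : ContMDiff (𝓡 n) (𝓡 n).tangent ∞ (fun y ↦ (⟨y, Z y⟩ : TangentBundle (𝓡 n) G)))

include hZ

/-- The Leibniz rule on the frame expansion: the product `D` plus the derivative of the
coefficients. -/
lemma leftTriv_cov (x : G) (v : TangentSpace (𝓡 n) x) :
    leftTriv x (cov Z x v) = D (leftTriv x v) (leftTriv x (Z x)) + frameDeriv b Z x v := by
  have h := leftTriv_cov_sum hD (fun i y ↦ b.coord i (leftTriv y (Z y))) b x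
    (fun i ↦ (contMDiff_leftTriv _ hZ).contMDiffAt.mdifferentiableAt (by simp)) v
  rw [← funext (sum_coord_smul_mulInvariantVectorField b Z)] at h
  rw [h, Finset.sum_add_distrib, frameDeriv]
  congr 1
  conv_rhs => rw [← b.sum_repr (leftTriv x (Z x))]
  simp only [map_sum, map_smul, Module.Basis.coord_apply]

include hY

lemma leftTriv_cov_cov (x : G) (v : TangentSpace (𝓡 n) x) :
    leftTriv x (cov (fun y ↦ cov Z y (Y y)) x v) =
      D (leftTriv x v) (D (leftTriv x (Y x)) (leftTriv x (Z x))) +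
      D (leftTriv x v) (frameDeriv b Z x (Y x)) +
      D (frameDeriv b Y x v) (leftTriv x (Z x)) +
      D (leftTriv x (Y x)) (frameDeriv b Z x v) +
      ∑ i, mvfderiv (𝓡 n) (fun y ↦ mvfderiv (𝓡 n) (fun z ↦ b.coord i (leftTriv z (Z z))) y (Y y))
        x v • b i := by
  set ζ : ι → G → ℝ := fun i y ↦ b.coord i (leftTriv y (Z y)) with hζ
  set η : ι → G → ℝ := fun i y ↦ b.coord i (leftTriv y (Y y)) with hη
  have cζ : ∀ i, ContMDiff (𝓡 n) 𝓘(ℝ, ℝ) ∞ (ζ i) := fun i ↦ contMDiff_leftTriv _ hZ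
  have cη : ∀ i, ContMDiff (𝓡 n) 𝓘(ℝ, ℝ) ∞ (η i) := fun i ↦ contMDiff_leftTriv _ hY
  have dζ : ∀ i, MDifferentiableAt (𝓡 n) 𝓘(ℝ, ℝ) (ζ i) x :=
    fun i ↦ (cζ i).contMDiffAt.mdifferentiableAt (by simp)
  have dη : ∀ i, MDifferentiableAt (𝓡 n) 𝓘(ℝ, ℝ) (η i) x :=
    fun i ↦ (cη i).contMDiffAt.mdifferentiableAt (by simp)
  have rζ : ∀ y, leftTriv y (Z y) = ∑ i, ζ i y • b i := fun y ↦ (b.sum_repr _).symm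
  have rη : ∀ y, leftTriv y (Y y) = ∑ i, η i y • b i := fun y ↦ (b.sum_repr _).symm
  -- The connection is not assumed smooth, so differentiability of `∇_Y Z` comes from an explicit
  -- expansion: coefficients `Y(ζ_i)` on the fields `b i`, and `η_i ζ_j` on the fields `D (b i) (b
  -- j)`.
  let f : ι ⊕ ι × ι → G → ℝ :=
    Sum.elim (fun i y ↦ mvfderiv (𝓡 n) (ζ i) y (Y y)) (fun p ↦ η p.1 * ζ p.2)
  let w : ι ⊕ ι × ι → GroupLieAlgebra (𝓡 n) G := Sum.elim b (fun p ↦ D (b p.1) (b p.2))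
  have e : (fun y ↦ cov Z y (Y y)) = fun y ↦ ∑ i, f i y • mulInvariantVectorField (w i) y := by
    ext1 y
    apply leftTriv_injective y
    rw [leftTriv_cov b hD hZ, rζ, rη]
    simp only [f, w, map_sum, map_add, map_smul, leftTriv_mulInvariantVectorField, Fintype.sum_sum_type,
      Sum.elim_inl, Sum.elim_inr, frameDeriv, Fintype.sum_prod_type, LinearMap.sum_apply,
      LinearMap.smul_apply, Pi.mul_apply, Finset.smul_sum, smul_smul]
    rw [add_comm, Finset.sum_comm]
    simp only [mul_comm]
    rfl
  have hf : ∀ i, MDifferentiableAt (𝓡 n) 𝓘(ℝ, ℝ) (f i) x := by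
    rintro (i | p)
    · exact (contMDiff_mvfderiv_apply (cζ i) hY).contMDiffAt.mdifferentiableAt (by simp)
    · exact (dη p.1).mul (dζ p.2)
  rw [e, leftTriv_cov_sum hD f w x hf v]
  simp only [f, w, Fintype.sum_sum_type, Sum.elim_inl, Sum.elim_inr, Fintype.sum_prod_type,
    mvfderiv_mul (dη _) (dζ _), add_apply, smul_apply, Pi.mul_apply, Finset.sum_add_distrib,
    add_smul]
  rw [rζ, rη]
  simp only [frameDeriv, map_sum, map_smul, LinearMap.sum_apply, LinearMap.smul_apply,
    Finset.smul_sum, smul_smul, smul_eq_mul]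
  have swap : ∀ F : ι → ι → GroupLieAlgebra (𝓡 n) G, ∑ i, ∑ j, F i j = ∑ j, ∑ i, F i j :=
    fun F ↦ Finset.sum_comm
  rw [swap (fun i j ↦ (ζ i x * η j x) • D (leftTriv x v) (D (b j) (b i))),
    swap (fun i j ↦ (ζ i x * mvfderiv (𝓡 n) (η j) x v) • D (b j) (b i)),
    swap (fun i j ↦ (mvfderiv (𝓡 n) (ζ i) x v * η j x) • D (b j) (b i))]
  simp only [mul_comm (ζ _ x) (η _ x), mul_comm (mvfderiv (𝓡 n) (ζ _) x v) (η _ x)]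
  abel

include hX

/-- The curvature of smooth vector fields, in the left trivialization. -/
lemma leftTriv_curvature (htor : cov.torsion = 0) (hDtor : ∀ V W, D V W - D W V = ⁅V, W⁆) (x : G) :
    leftTriv x (curvature cov X Y Z x) =
      productCurvature D (leftTriv x (X x)) (leftTriv x (Y x)) (leftTriv x (Z x)) := by
  let b : Module.Basis (Fin n) ℝ (GroupLieAlgebra (𝓡 n) G) :=
    (EuclideanSpace.basisFun (Fin n) ℝ).toBasis
  have hT := (CovariantDerivative.torsion_eq_zero_iff cov).1 htor
    (hX.contMDiffAt.mdifferentiableAt (by simp) (x := x))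
    (hY.contMDiffAt.mdifferentiableAt (by simp) (x := x))
  have hT' := congrArg (leftTriv x) hT
  rw [map_sub, leftTriv_cov b hD hX, leftTriv_cov b hD hY] at hT'
  -- Zero torsion computes the bracket in the trivialization; its derivative terms cancel the terms
  -- of `leftTriv_cov_cov` that differentiate `X` and `Y`.
  have hb : leftTriv x (mlieBracket (𝓡 n) X Y x) = ⁅leftTriv x (X x), leftTriv x (Y x)⁆ +
      frameDeriv b Y x (X x) - frameDeriv b X x (Y x) := by
    rw [← hT', ← hDtor]
    abel
  -- The second derivatives of the coefficients of `Z` cancel against the derivative along `[X, Y]`.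
  have hc : frameDeriv b Z x (mlieBracket (𝓡 n) X Y x) =
      ∑ i, mvfderiv (𝓡 n) (fun y ↦ mvfderiv (𝓡 n) (fun z ↦ b.coord i (leftTriv z (Z z))) y (Y y))
        x (X x) • b i -
      ∑ i, mvfderiv (𝓡 n) (fun y ↦ mvfderiv (𝓡 n) (fun z ↦ b.coord i (leftTriv z (Z z))) y (X y))
        x (Y x) • b i := by
    simp only [frameDeriv, mvfderiv_mlieBracket (contMDiff_leftTriv _ hZ) hX hY, sub_smul,
      Finset.sum_sub_distrib]
  rw [curvature, map_sub, map_sub, leftTriv_cov_cov b hD hY hZ, leftTriv_cov_cov b hD hX hZ,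
    leftTriv_cov b hD hZ, hb, hc]
  simp only [productCurvature, map_add, map_sub, LinearMap.add_apply, LinearMap.sub_apply]
  abel

end Curvature

/-! ### From the Lie algebra to the group. -/

lemma sectionalCurvatureLE_leftInvariantMetric {n : ℕ} {G : Type*} [TopologicalSpace G]
    [ChartedSpace (EuclideanSpace ℝ (Fin n)) G] [Group G] [LieGroup (𝓡 n) ∞ G]
    {θ : GroupLieAlgebra (𝓡 n) G →ₗ⁅ℝ⁆ GroupLieAlgebra (𝓡 n) G} (hθ : IsCartanInvolution θ)
    {c : ℝ} (hc : 0 < c) {k α : ℝ} (hk : 1 / 2 ≤ k) (hk1 : α ^ 2 / 4 < k)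
    (hk2 : (2 * k - 1 - 5 / 2 * α) ^ 2 ≤ 4 * (k - α ^ 2 / 4) * (k + 7 / 4))
    (hα : constC2 θ (canonicalForm c θ) = α * constC1 θ (canonicalForm c θ)) :
    SectionalCurvatureLE (leftInvariantMetric (canonicalForm c θ))
      (k * constC1 θ (canonicalForm c θ) ^ 2) := by
  intro cov hcov X Y hX hY x hXY
  have : FiniteDimensional ℝ (GroupLieAlgebra (𝓡 n) G) :=
    inferInstanceAs (FiniteDimensional ℝ (EuclideanSpace ℝ (Fin n)))
  have hcurv := leftTriv_curvature (leftTriv_cov_invariant hθ hc hcov) hX hY hY hcov.torsion_free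
    (leviCivitaProduct_sub_swap θ) x
  have hli : LinearIndependent ℝ ![leftTriv x (X x), leftTriv x (Y x)] := by
    have h := hXY.map' (leftTriv x) (LinearMap.ker_eq_bot.2 (leftTriv_injective x))
    have e : leftTriv x ∘ ![X x, Y x] = ![leftTriv x (X x), leftTriv x (Y x)] := by
      ext1 i
      fin_cases i <;> rfl
    rw [e] at h
    exact h
  have key := hθ.canonicalForm_productCurvature_div_le hc hk hk1 hk2 hα hli
  simp only [sectionalCurvature, leftInvariantMetric_apply, hcurv]
  exact key

theorem proposition5 {n : ℕ} {G : Type*} [TopologicalSpace G]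
    [ChartedSpace (EuclideanSpace ℝ (Fin n)) G] [Group G] [LieGroup (𝓡 n) ∞ G]
    [LieAlgebra.IsSemisimple ℝ (GroupLieAlgebra (𝓡 n) G)]
    (θ : GroupLieAlgebra (𝓡 n) G →ₗ⁅ℝ⁆ GroupLieAlgebra (𝓡 n) G) (hθ : IsCartanInvolution θ)
    (c : ℝ) (hc : 0 < c) :
    (constC2 θ (canonicalForm c θ) / constC1 θ (canonicalForm c θ) = 1 →
      SectionalCurvatureLE (leftInvariantMetric (canonicalForm c θ))
        (49 / 52 * constC1 θ (canonicalForm c θ) ^ 2)) ∧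
    (constC2 θ (canonicalForm c θ) / constC1 θ (canonicalForm c θ) = Real.sqrt 2 →
      SectionalCurvatureLE (leftInvariantMetric (canonicalForm c θ))
        (1.17259 * constC1 θ (canonicalForm c θ) ^ 2)) := by
  have ratio : ∀ {α : ℝ}, α ≠ 0 →
      constC2 θ (canonicalForm c θ) / constC1 θ (canonicalForm c θ) = α →
      constC2 θ (canonicalForm c θ) = α * constC1 θ (canonicalForm c θ) := by
    intro α hα h
    -- Division by zero gives 0, so a nonzero ratio already forces `C₁ ≠ 0`.
    have h0 : constC1 θ (canonicalForm c θ) ≠ 0 := by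
      intro h0
      rw [h0, div_zero] at h
      exact hα h.symm
    rw [← h, div_mul_cancel₀ _ h0]
  refine ⟨fun h ↦ ?_, fun h ↦ ?_⟩
  · exact sectionalCurvatureLE_leftInvariantMetric hθ hc (by norm_num) (by norm_num) (by norm_num)
      (ratio one_ne_zero h)
  · have h2 : √(2 : ℝ) ^ 2 = 2 := Real.sq_sqrt (by norm_num)
    -- For `α = √2` the discriminant condition reduces to `17 - 9k + (5 - 10k)√2 ≤ 0`. At `k =
    -- 1.17259` the coefficient of `√2` is negative, and the crude bound `1 ≤ √2` is enough.
    have h3 : 1 ≤ √(2 : ℝ) := Real.one_le_sqrt.2 (by norm_num)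
    refine sectionalCurvatureLE_leftInvariantMetric hθ hc (by norm_num) ?_ ?_
      (ratio (by positivity) h)
    · rw [h2]
      norm_num
    · rw [h2]
      linarith
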